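/- Let $\mathfrak k$ be a compact semisimple real Lie algebra (finite-dimensional, with negative definite Killing form), $\mathfrak t\subset\mathfrak k$ a Cartan subalgebra, $\mathfrak g=\mathfrak k\otimes_{\mathbb R}\mathbb C$, $\Delta$ the roots of $(\mathfrak g,\mathfrak t_{\mathbb C})$ with root spaces $\mathfrak g_\alpha$, and $\Delta^+$ the positive roots for a choice of simple roots. For a simple root $\phi$, let $\Delta_c\subset\Delta$ be the set of roots whose coefficient along $\phi$ (in the expansion in simple roots) is $0$, let $$\mathfrak k_\phi=\mathfrak t\oplus\bigoplus_{\alpha\in\Delta_c\cap\Delta^+}(\mathfrak g_\alpha\oplus\mathfrak g_{-\alpha})\cap\mathfrak k ,$$ and let $\rho_\phi\in\mathfrak t$ be the element with $\alpha(\rho_\phi)=0$ for all $\alpha\in\Delta_c$ and $\phi(\rho_\phi)=i$. Let $R_\Lambda:\mathfrak k\to\mathrm{End}_{\mathbb C}(V(\Lambda))$ be a finite-dimensional complex irreducible representation of highest weight $\Lambda$, and for $\ell=0,1,2,\dots$ let $V(\Lambda)_\ell$ be the eigenspace of $R_\Lambda(\rho_\phi)$ for the eigenvalue $\Lambda(\rho_\phi)-i\ell$.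 The representation is called $\phi$-minimal if $V(\Lambda)=V(\Lambda)_0\oplus V(\Lambda)_1$ with both summands nonzero and $V(\Lambda)_0$ is irreducible under $\mathfrak k_\phi$. **Proposition.** 1. If $\mathfrak k=\mathfrak e_6$, with simple roots labelled so that the Dynkin diagram is the chain $\alpha_1-\alpha_2-\alpha_3-\alpha_5-\alpha_6$ together with $\alpha_4$ joined to $\alpha_3$, and $\phi=\alpha_6$, then $\mathfrak k$ has no $\phi$-minimal irreducible representation. 2. If $\mathfrak k=\mathfrak e_7$, with simple roots labelled so that the Dynkin diagram is the chain $\alpha_1-\alpha_2-\alpha_3-\alpha_4-\alpha_6-\alpha_7$ together with $\alpha_5$ joined to $\alpha_4$, and $\phi=\alpha_1$, then $\mathfrak k$ has no $\phi$-minimal irreducible representation. -/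

import Mathlib

open scoped TensorProduct

attribute [local instance 100] LieRing.ofAssociativeRing

noncomputable section

namespace CompactHermitian

/-- A finite-dimensional real Lie algebra is compact semisimple (the compact real form of its
complexification) if its Killing form is negative definite. -/
class IsCompactSemisimple (k : Type*) [LieRing k] [LieAlgebra ℝ k] : Prop where
  killing_neg : ∀ x : k, x ≠ 0 → killingForm ℝ k x x < 0

section Complexification

variable {k : Type*} [LieRing k] [LieAlgebra ℝ k]

theorem exists_re_im (z : ℂ ⊗[ℝ] k) :
    ∃ x y : k, z = (1 : ℂ) ⊗ₜ[ℝ] x + Complex.I • ((1 : ℂ) ⊗ₜ[ℝ] y) := by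
  induction z using TensorProduct.induction_on with
  | zero => exact ⟨0, 0, by simp⟩
  | tmul c x =>
    refine ⟨c.re • x, c.im • x, ?_⟩
    rw [TensorProduct.smul_tmul', ← TensorProduct.smul_tmul, ← TensorProduct.smul_tmul,
      ← TensorProduct.add_tmul]
    congr 1
    apply Complex.ext <;> simp
  | add z w hz hw =>
    obtain ⟨x, y, rfl⟩ := hz
    obtain ⟨x', y', rfl⟩ := hw
    refine ⟨x + x', y + y', ?_⟩
    simp only [TensorProduct.tmul_add, smul_add]
    abel

/-- The complexification `ℂ ⊗ t`, as a subalgebra of `ℂ ⊗ k`, of a subalgebra `t` of `k`. -/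
def complexify (t : LieSubalgebra ℝ k) : LieSubalgebra ℂ (ℂ ⊗[ℝ] k) where
  __ := t.toSubmodule.baseChange ℂ
  lie_mem' := by
    intro a b ha hb
    simp only [AddSubsemigroup.mem_carrier, AddSubmonoid.mem_toSubsemigroup,
      Submodule.mem_toAddSubmonoid, Submodule.baseChange_eq_span] at ha hb ⊢
    induction ha, hb using Submodule.span_induction₂ with
    | mem_mem x y hx hy =>
      obtain ⟨x, hx, rfl⟩ := hx
      obtain ⟨y, hy, rfl⟩ := hy
      refine Submodule.subset_span ⟨⁅x, y⁆, t.lie_mem hx hy, ?_⟩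
      simp
    | zero_left => simp
    | zero_right => simp
    | add_left x y z _ _ _ h₁ h₂ => rw [add_lie]; exact add_mem h₁ h₂
    | add_right x y z _ _ _ h₁ h₂ => rw [lie_add]; exact add_mem h₁ h₂
    | smul_left r x y _ _ h => rw [smul_lie]; exact Submodule.smul_mem _ _ h
    | smul_right r x y _ _ h => rw [lie_smul]; exact Submodule.smul_mem _ _ h

theorem one_tmul_mem_complexify (t : LieSubalgebra ℝ k) {x : k} (hx : x ∈ t) :
    (1 : ℂ) ⊗ₜ[ℝ] x ∈ complexify t :=
  Submodule.tmul_mem_baseChange_of_mem 1 hx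

theorem re_im_ext {x y x' y' : k}
    (h : (1 : ℂ) ⊗ₜ[ℝ] x + Complex.I • ((1 : ℂ) ⊗ₜ[ℝ] y) =
      (1 : ℂ) ⊗ₜ[ℝ] x' + Complex.I • ((1 : ℂ) ⊗ₜ[ℝ] y')) : x = x' ∧ y = y' := by
  have h₁ := congrArg ((TensorProduct.lid ℝ k) ∘ (LinearMap.rTensor k Complex.reLm)) h
  have h₂ := congrArg ((TensorProduct.lid ℝ k) ∘ (LinearMap.rTensor k Complex.imLm)) h
  simp [TensorProduct.smul_tmul'] at h₁ h₂
  exact ⟨h₁, h₂⟩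

theorem re_im_mem_complexify_iff (t : LieSubalgebra ℝ k) {x y : k} :
    (1 : ℂ) ⊗ₜ[ℝ] x + Complex.I • ((1 : ℂ) ⊗ₜ[ℝ] y) ∈ complexify t ↔ x ∈ t ∧ y ∈ t := by
  refine ⟨fun h => ?_, fun h => add_mem (one_tmul_mem_complexify t h.1)
    ((complexify t).smul_mem _ (one_tmul_mem_complexify t h.2))⟩
  obtain ⟨w, hw⟩ := t.toSubmodule.toBaseChange_surjective ℂ ⟨_, h⟩
  obtain ⟨a, b, rfl⟩ := exists_re_im (k := t) w
  have hw' := congrArg Subtype.val hw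
  rw [map_add, map_smul] at hw'
  obtain ⟨rfl, rfl⟩ := re_im_ext hw'
  exact ⟨a.2, b.2⟩

/-- The inclusion of `t` in its complexification. -/
def toComplexify (t : LieSubalgebra ℝ k) (x : t) : complexify t :=
  ⟨(1 : ℂ) ⊗ₜ[ℝ] (x : k), one_tmul_mem_complexify t x.2⟩

end Complexification

variable {k : Type*} [LieRing k] [LieAlgebra ℝ k]

section Instances

variable [IsCompactSemisimple k] [FiniteDimensional ℝ k]

instance : LieAlgebra.IsKilling ℝ k where
  killingCompl_top_eq_bot := by
    rw [LieSubmodule.eq_bot_iff]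
    intro x hx
    by_contra h
    have h₁ := IsCompactSemisimple.killing_neg x h
    rw [LieIdeal.mem_killingCompl] at hx
    exact h₁.ne (hx x (by simp))

instance : LieAlgebra.IsKilling ℂ (ℂ ⊗[ℝ] k) where
  killingCompl_top_eq_bot := by
    rw [LieSubmodule.eq_bot_iff]
    intro z hz
    rw [LieIdeal.mem_killingCompl] at hz
    obtain ⟨x, y, rfl⟩ := exists_re_im z
    have key : ∀ c : k, killingForm ℝ k c x = 0 ∧ killingForm ℝ k c y = 0 := by
      intro c
      have h := hz ((1 : ℂ) ⊗ₜ[ℝ] c) (by simp)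
      rw [killingForm, LieModule.traceForm_baseChange] at h
      have h₁ := congrArg Complex.re h
      have h₂ := congrArg Complex.im h
      simp at h₁ h₂
      exact ⟨h₁, h₂⟩
    have hx : x = 0 := by
      by_contra h
      exact (IsCompactSemisimple.killing_neg x h).ne (key x).1
    have hy : y = 0 := by
      by_contra h
      exact (IsCompactSemisimple.killing_neg y h).ne (key y).2
    simp [hx, hy]

instance (t : LieSubalgebra ℝ k) [t.IsCartanSubalgebra] :
    (complexify t).IsCartanSubalgebra where
  nilpotent := by
    have habel : ∀ x ∈ t, ∀ y ∈ t, ⁅x, y⁆ = 0 := fun x hx y hy =>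
      congrArg Subtype.val (LieModule.IsTrivial.trivial (⟨x, hx⟩ : t) (⟨y, hy⟩ : t))
    have : IsLieAbelian (complexify t) := by
      refine ⟨fun z w => ?_⟩
      obtain ⟨z, hz⟩ := z
      obtain ⟨w, hw⟩ := w
      obtain ⟨a, b, rfl⟩ := exists_re_im z
      obtain ⟨c, d, rfl⟩ := exists_re_im w
      obtain ⟨ha, hb⟩ := (re_im_mem_complexify_iff t).1 hz
      obtain ⟨hc, hd⟩ := (re_im_mem_complexify_iff t).1 hw
      apply Subtype.ext
      change ⁅(1 : ℂ) ⊗ₜ[ℝ] a + Complex.I • ((1 : ℂ) ⊗ₜ[ℝ] b),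
        (1 : ℂ) ⊗ₜ[ℝ] c + Complex.I • ((1 : ℂ) ⊗ₜ[ℝ] d)⁆ = 0
      rw [add_lie, lie_add, lie_add, lie_smul, lie_smul,
        LieModule.smul_lie (R := ℂ) (L := ℂ ⊗[ℝ] k) (M := ℂ ⊗[ℝ] k),
        LieModule.smul_lie (R := ℂ) (L := ℂ ⊗[ℝ] k) (M := ℂ ⊗[ℝ] k)]
      simp [habel a ha c hc, habel a ha d hd, habel b hb c hc, habel b hb d hd]
    infer_instance
  self_normalizing := by
    refine le_antisymm (fun z hz => ?_) (LieSubalgebra.le_normalizer _)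
    obtain ⟨a, b, rfl⟩ := exists_re_im z
    rw [LieSubalgebra.mem_normalizer_iff] at hz
    have hab : ∀ c ∈ t, ⁅c, a⁆ ∈ t ∧ ⁅c, b⁆ ∈ t := fun c hc => by
      have h := hz _ (one_tmul_mem_complexify t hc)
      rw [← lie_skew, neg_mem_iff, lie_add, lie_smul,
        LieAlgebra.ExtendScalars.bracket_tmul, LieAlgebra.ExtendScalars.bracket_tmul,
        one_mul] at h
      exact (re_im_mem_complexify_iff t).1 h
    have hn : t.normalizer = t := LieSubalgebra.IsCartanSubalgebra.self_normalizing
    refine (re_im_mem_complexify_iff t).2 ⟨?_, ?_⟩ <;> rw [← hn, LieSubalgebra.mem_normalizer_iff']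
    · exact fun c hc => (hab c hc).1
    · exact fun c hc => (hab c hc).2

end Instances

section Representations

variable [IsCompactSemisimple k] [FiniteDimensional ℝ k]
variable (t : LieSubalgebra ℝ k) [t.IsCartanSubalgebra]

/-- The roots, with respect to the complexified Cartan subalgebra, of the complexification of
`k`. -/
abbrev Root := (complexify t).root

/-- The root system of the complexification of `k`. -/
abbrev rootSys :
    RootPairing (Root t) ℂ (Module.Dual ℂ (complexify t)) (complexify t) :=
  LieAlgebra.IsKilling.rootSystem (complexify t)

variable {t}

/-- The root space `𝔤_α`. -/
def rootSpace (α : Root t) : Submodule ℂ (ℂ ⊗[ℝ] k) :=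
  (LieAlgebra.rootSpace (complexify t) (α.1 : complexify t → ℂ)).toSubmodule

/-- The root space `𝔤_{-α}`. -/
def negRootSpace (α : Root t) : Submodule ℂ (ℂ ⊗[ℝ] k) :=
  (LieAlgebra.rootSpace (complexify t) (-(α.1 : complexify t → ℂ))).toSubmodule

variable (b : (rootSys t).Base) (φ : b.support)

/-- A root is compact (with respect to the simple root `φ`) if its coefficient along `φ`, in its
expansion in the simple roots, vanishes. -/
def IsCompactRoot (α : Root t) : Prop :=
  b.toWeightBasis.repr ((rootSys t).root α) φ = 0

/-- The subalgebra `𝔨_φ = 𝔱 ∔ ∑ (𝔤_α ∔ 𝔤_{-α}) ∩ 𝔨`, the sum being over the compact positive roots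
`α`, as a real subspace of `𝔨`. -/
def kPhi : Submodule ℝ k :=
  t.toSubmodule ⊔ ⨆ α : {α : Root t // b.IsPos α ∧ IsCompactRoot b φ α},
    ((rootSpace α.1 ⊔ negRootSpace α.1).restrictScalars ℝ).comap
      (TensorProduct.mk ℝ ℂ k 1)

/-- `ρ` is the generator `ρ_φ ∈ 𝔱` of the centre of `𝔨_φ`: every compact root vanishes on it, and
`φ(ρ_φ) = i`. -/
def IsRhoPhi (ρ : t) : Prop :=
  (∀ α : Root t, IsCompactRoot b φ α → α.1 (toComplexify t ρ) = 0) ∧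
    (φ : Root t).1 (toComplexify t ρ) = Complex.I

variable {V : Type*} [AddCommGroup V] [Module ℂ V]

/-- The complex subspace `U` of `V` is stable under the operators `R x`, `x ∈ s`, and is nonzero
and has no stable complex subspace other than `0` and itself. -/
def IsIrreducibleOn (R : k →ₗ⁅ℝ⁆ Module.End ℂ V) (s : Submodule ℝ k) (U : Submodule ℂ V) : Prop :=
  U ≠ ⊥ ∧ (∀ x ∈ s, ∀ v ∈ U, R x v ∈ U) ∧
    ∀ W : Submodule ℂ V, W ≤ U → (∀ x ∈ s, ∀ v ∈ W, R x v ∈ W) → W = ⊥ ∨ W = U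

/-- Irreducibility of a complex representation of `𝔨`. -/
def IsIrreducibleRep (R : k →ₗ⁅ℝ⁆ Module.End ℂ V) : Prop :=
  IsIrreducibleOn R ⊤ ⊤

/-- The action of the complexification of `𝔨`, by complex linear extension of `R`. -/
def extend (R : k →ₗ⁅ℝ⁆ Module.End ℂ V) : ℂ ⊗[ℝ] k →ₗ[ℂ] Module.End ℂ V :=
  LinearMap.liftBaseChange ℂ (R : k →ₗ[ℝ] Module.End ℂ V)

/-- `Λ` is a highest weight of `R`: there is a nonzero vector of weight `Λ` that is annihilated by
all positive root vectors. -/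
def IsHighestWeight (R : k →ₗ⁅ℝ⁆ Module.End ℂ V) (Λ : t →ₗ[ℝ] ℂ) : Prop :=
  ∃ v : V, v ≠ 0 ∧ (∀ h : t, R h v = Λ h • v) ∧
    ∀ α : Root t, b.IsPos α → ∀ x ∈ rootSpace α, extend R x v = 0

/-- `V(Λ)_ℓ`, the eigenspace of `ρ_φ` in `V(Λ)` for the eigenvalue `Λ(ρ_φ) - i ℓ`. -/
def level (R : k →ₗ⁅ℝ⁆ Module.End ℂ V) (Λ : t →ₗ[ℝ] ℂ) (ρ : t) (l : ℕ) : Submodule ℂ V :=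
  Module.End.eigenspace (R ρ) (Λ ρ - Complex.I * l)

/-- The (irreducible) representation `R` is `φ`-minimal: if `Λ` is its highest weight, then
`V(Λ) = V(Λ)_0 ⊕ V(Λ)_1` with both summands nonzero, and `V(Λ)_0` is irreducible under `𝔨_φ`. -/
def IsPhiMinimal (R : k →ₗ⁅ℝ⁆ Module.End ℂ V) : Prop :=
  ∃ (Λ : t →ₗ[ℝ] ℂ) (ρ : t), IsHighestWeight b R Λ ∧ IsRhoPhi b φ ρ ∧
    IsCompl (level R Λ ρ 0) (level R Λ ρ 1) ∧
    level R Λ ρ 0 ≠ ⊥ ∧ level R Λ ρ 1 ≠ ⊥ ∧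
    IsIrreducibleOn R (kPhi b φ) (level R Λ ρ 0)

end Representations

/-- The Cartan matrix of type `E₆`, in the labelling with Dynkin diagram
`α₁ - α₂ - α₃ - α₅ - α₆` and `α₄` attached to `α₃`. The indices `0, …, 5` stand for
`α₁, …, α₆`. -/
def cartanE6 : Matrix (Fin 6) (Fin 6) ℤ :=
  !![ 2, -1,  0,  0,  0,  0;
     -1,  2, -1,  0,  0,  0;
      0, -1,  2, -1, -1,  0;
      0,  0, -1,  2,  0,  0;
      0,  0, -1,  0,  2, -1;
      0,  0,  0,  0, -1,  2]

/-- The Cartan matrix of type `E₇`, in the labelling with Dynkin diagram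
`α₁ - α₂ - α₃ - α₄ - α₆ - α₇` and `α₅` attached to `α₄`. The indices `0, …, 6` stand for
`α₁, …, α₇`. -/
def cartanE7 : Matrix (Fin 7) (Fin 7) ℤ :=
  !![ 2, -1,  0,  0,  0,  0,  0;
     -1,  2, -1,  0,  0,  0,  0;
      0, -1,  2, -1,  0,  0,  0;
      0,  0, -1,  2, -1, -1,  0;
      0,  0,  0, -1,  2,  0,  0;
      0,  0,  0, -1,  0,  2, -1;
      0,  0,  0,  0,  0, -1,  2]

theorem cartanE6_eq :
    cartanE6 = CartanMatrix.E₆.submatrix ![0, 2, 3, 1, 4, 5] ![0, 2, 3, 1, 4, 5] := by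
  decide

theorem cartanE7_eq :
    cartanE7 = CartanMatrix.E₇.submatrix ![6, 5, 4, 3, 1, 2, 0] ![6, 5, 4, 3, 1, 2, 0] := by
  decide

end CompactHermitian

end

/-! Let `v` be a highest weight vector and `γ`, `δ` orthogonal positive roots, each with coefficient
1 along `φ`. Each of the lowering operators for `γ`, `δ` decreases the level by one in the
decomposition by `ρ_φ`. If only levels 0 and 1 occur, every product of two of them kills `v`. By
`sl₂`-theory `Λ` is then at most 1 on each coroot, and it cannot be 1 on both, so `Λ(γ^∨) + Λ(δ^∨) ≤
1` (`exists_nat_add_le_one`).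

If moreover every simple coroot occurs in `γ^∨ + δ^∨` with coefficient at least 2, the same sum is
at least `2 Λ(αᵢ^∨)` for each `i`. Hence `Λ = 0`, the representation is trivial
(`map_eq_zero_of_simple`), and level 1 vanishes, a contradiction (`not_isPhiMinimal_of_hasCoeffs`).

What remains is to exhibit such a pair in `E₆` and in `E₇`: `γ` is the highest root, and `δ` is the
highest root of the subsystem generated by the simple roots orthogonal to `γ`. -/

noncomputable section

namespace CompactHermitian

/-! ### Integer coefficient vectors of roots in the simply laced case. -/

section RootCombinatorics

variable {ι K M N : Type*} [Field K] [AddCommGroup M] [Module K M]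
  [AddCommGroup N] [Module K N] {P : RootPairing ι K M N} {b : P.Base} {n : ℕ}

/-- The root `γ` and its coroot have the same coefficients `c` in terms of the simple roots and
coroots, respectively (as happens in simply laced root systems). -/
structure HasCoeffs (e : Fin n ≃ b.support) (c : Fin n → ℤ) (γ : ι) : Prop where
  root_eq : P.root γ = ∑ i, c i • P.root (e i)
  coroot_eq : P.coroot γ = ∑ i, c i • P.coroot (e i)

/-- The action of the `j`-th simple reflection on the coefficients of a root. -/
def reflectCoeffs (C : Matrix (Fin n) (Fin n) ℤ) (j : Fin n) (c : Fin n → ℤ) : Fin n → ℤ :=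
  c - Pi.single j (∑ i, c i * C i j)

namespace HasCoeffs

variable {e : Fin n ≃ b.support} {C : Matrix (Fin n) (Fin n) ℤ} {c d : Fin n → ℤ} {γ δ : ι}

theorem simple (i : Fin n) : HasCoeffs e (Pi.single i 1) (e i : ι) where
  root_eq := by simp [Pi.single_apply, ite_smul]
  coroot_eq := by simp [Pi.single_apply, ite_smul]

theorem height_eq [CharZero K] (hγ : HasCoeffs e c γ) : b.height γ = ∑ i, c i := by
  classical
  have h := hγ.root_eq
  let f : ι → ℤ := fun j => if hj : j ∈ b.support then c (e.symm ⟨j, hj⟩) else 0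
  have hf : ∀ j : b.support, f j = c (e.symm j) := fun j => by simp [f]
  have hs : P.root γ = ∑ j ∈ b.support, f j • P.root j := by
    rw [h, ← Finset.sum_coe_sort b.support, ← e.sum_comp]
    simp [hf]
  rw [RootPairing.Base.height_eq_sum hs, ← Finset.sum_coe_sort b.support, ← e.sum_comp]
  simp [hf]

variable [P.IsCrystallographic]

theorem pairing_eq (hC : ∀ i j, b.cartanMatrix (e i) (e j) = C i j)
    (hγ : HasCoeffs e c γ) (hδ : HasCoeffs e d δ) :
    P.pairing γ δ = ((∑ i, ∑ j, c i * d j * C i j : ℤ) : K) := by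
  have h : ∀ i j, P.toLinearMap (P.root (e i)) (P.coroot (e j)) = (C i j : K) := fun i j => by
    rw [← hC i j, RootPairing.Base.cartanMatrix, RootPairing.Base.cartanMatrixIn, Matrix.of_apply,
      RootPairing.root_coroot_eq_pairing]
    exact (P.algebraMap_pairingIn ℤ (e i) (e j)).symm
  rw [← P.root_coroot_eq_pairing, hγ.root_eq, hδ.coroot_eq]
  simp only [map_sum, map_zsmul, LinearMap.sum_apply, LinearMap.smul_apply, h, zsmul_eq_mul]
  push_cast
  rw [Finset.sum_comm]
  simp only [Finset.mul_sum]
  exact Finset.sum_congr rfl fun _ _ => Finset.sum_congr rfl fun _ _ => by ring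

/-- Symmetry of the Cartan matrix makes `⟨γ, αⱼ^∨⟩` and `⟨αⱼ, γ^∨⟩` equal, so the reflection changes
the root and coroot coefficients by the same amount. -/
theorem reflect (hC : ∀ i j, b.cartanMatrix (e i) (e j) = C i j) (hsymm : C.IsSymm)
    (hγ : HasCoeffs e c γ) (j : Fin n) :
    HasCoeffs e (reflectCoeffs C j c) (P.reflectionPerm (e j) γ) := by
  have h₁ : P.pairing γ (e j) = ((∑ i, c i * C i j : ℤ) : K) := by
    rw [pairing_eq hC hγ (simple j)]
    simp [Pi.single_apply]
  have h₂ : P.pairing (e j) γ = ((∑ i, c i * C i j : ℤ) : K) := by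
    rw [pairing_eq hC (simple j) hγ]
    simp [Pi.single_apply, hsymm.apply]
  constructor
  · rw [P.root_reflectionPerm, P.reflection_apply_root, h₁, Int.cast_smul_eq_zsmul, hγ.root_eq]
    simp [reflectCoeffs, sub_smul, Pi.single_apply, ite_smul]
  · rw [P.coroot_reflectionPerm, P.coreflection_apply_coroot, h₂, Int.cast_smul_eq_zsmul,
      hγ.coroot_eq]
    simp [reflectCoeffs, sub_smul, Pi.single_apply, ite_smul]

/-- Produces roots with prescribed coefficients from words in simple reflections, without
classifying the roots. The last letter of the word acts first. -/
theorem exists_foldr (hC : ∀ i j, b.cartanMatrix (e i) (e j) = C i j) (hsymm : C.IsSymm)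
    (l : List (Fin n)) (i : Fin n) :
    ∃ γ : ι, HasCoeffs e (l.foldr (reflectCoeffs C) (Pi.single i 1)) γ := by
  induction l with
  | nil => exact ⟨_, simple i⟩
  | cons j l ih =>
    obtain ⟨γ, hγ⟩ := ih
    exact ⟨_, hγ.reflect hC hsymm j⟩

end HasCoeffs

end RootCombinatorics


/-! ### Highest weight vectors and `sl₂`-triples. -/

section Representation

open LieAlgebra LieAlgebra.IsKilling Module

variable {K L V : Type*} [Field K] [LieRing L] [LieAlgebra K L]
  [AddCommGroup V] [Module K V] {σ : L →ₗ⁅K⁆ Module.End K V}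

theorem map_map_eq_of_lie_eq_smul {h x : L} {χ a : K} {w : V} (hx : ⁅h, x⁆ = χ • x)
    (hw : σ h w = a • w) : σ h (σ x w) = (a + χ) • σ x w := by
  have h₁ := congrArg (fun y => σ y w) hx
  simp only [LieHom.map_lie, map_smul, Ring.lie_def, LinearMap.sub_apply, Module.End.mul_apply,
    LinearMap.smul_apply, hw] at h₁
  rw [sub_eq_iff_eq_add.1 h₁]
  module

variable [CharZero K]

/-- The module structure is put on `V` only inside the proof, so that `σ` can remain an explicit
homomorphism throughout. -/
theorem exists_nat_of_primitive [FiniteDimensional K V] {h e f : L} (ht : IsSl2Triple h e f)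
    {v : V} (hv : v ≠ 0) {a : K} (hh : σ h v = a • v) (he : σ e v = 0) :
    ∃ n : ℕ, a = n ∧ (σ f ^ (n + 1)) v = 0 ∧ ∀ i ≤ n, (σ f ^ i) v ≠ 0 := by
  let _ : LieRingModule L V := LieRingModule.compLieHom V σ
  have : LieModule K L V := LieModule.compLieHom V σ
  have P : ht.HasPrimitiveVectorWith v a := ⟨hv, hh, he⟩
  obtain ⟨n, rfl⟩ := P.exists_nat
  exact ⟨n, rfl, P.pow_toEnd_f_eq_zero_of_eq_nat rfl, fun i hi =>
    P.pow_toEnd_f_ne_zero_of_eq_nat rfl hi⟩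

variable [FiniteDimensional K L] {H : LieSubalgebra K L} [H.IsCartanSubalgebra]
  [IsKilling K L] [LieModule.IsTriangularizable K H L] [FiniteDimensional K V]

theorem exists_sl2Triple (α : H.root) :
    ∃ e f : L, IsSl2Triple (coroot α.1 : L) e f ∧ e ∈ LieAlgebra.rootSpace H α.1 ∧ f ∈ LieAlgebra.rootSpace H (-(α.1 : H → K)) := by
  have hα : α.1.IsNonZero := H.isNonZero_coe_root α
  obtain ⟨h, e, f, ht, he, hf⟩ := exists_isSl2Triple_of_weight_isNonZero hα
  obtain rfl := ht.h_eq_coroot hα he hf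
  exact ⟨e, f, ht, he, hf⟩

variable {b : (rootSystem H).Base} {v : V}

/-- If a highest weight vector is killed by the simple coroots, then it is killed by everything. -/
theorem map_eq_zero_of_simple (hv : v ≠ 0)
    (hpos : ∀ α : H.root, b.IsPos α → ∀ x ∈ LieAlgebra.rootSpace H α.1, σ x v = 0)
    (hsimple : ∀ i : b.support, σ (coroot (i : H.root).1 : H) v = 0) (x : L) : σ x v = 0 := by
  let S : Submodule K L := LinearMap.ker ((LinearMap.applyₗ v).comp (σ : L →ₗ[K] Module.End K V))
  have hS : ∀ y, y ∈ S ↔ σ y v = 0 := fun y => Iff.rfl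
  have hH : ∀ h : H, σ h v = 0 := fun h => by
    rw [← hS]
    induction b.toCoweightBasis.mem_span h using Submodule.span_induction with
    | mem y hy =>
      obtain ⟨i, rfl⟩ := hy
      rw [b.toCoweightBasis_apply, hS]
      exact hsimple i
    | zero => exact S.zero_mem
    | add y z _ _ hy hz => exact S.add_mem hy hz
    | smul a y _ hy => exact S.smul_mem a hy
  -- The coroot acts by 0 on `v`, so its `sl₂`-string has length one and `f` kills `v`; root spaces
  -- are one-dimensional, so `f` spans this one.
  have hneg : ∀ α : H.root, b.IsPos α → ∀ x ∈ LieAlgebra.rootSpace H (-(α.1 : H → K)), σ x v = 0 := by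
    intro α hα x hx
    obtain ⟨e, f, ht, he, hf⟩ := exists_sl2Triple α
    obtain ⟨n, hn, h₀, -⟩ := exists_nat_of_primitive (σ := σ) (a := 0) ht hv
      (by simpa using hH (coroot α.1)) (hpos α hα e he)
    obtain rfl : n = 0 := by exact_mod_cast hn.symm
    have hα' : α.1.IsNonZero := H.isNonZero_coe_root α
    obtain ⟨c, hc⟩ := (finrank_eq_one_iff_of_nonzero' ⟨f, hf⟩ (by simpa using ht.f_ne_zero)).mp
      (finrank_rootSpace_eq_one (-α.1) (by simpa)) ⟨x, hx⟩
    obtain rfl : c • f = x := by simpa using hc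
    simpa using Or.inr h₀
  suffices (⊤ : LieSubmodule K H L).toSubmodule ≤ S from this (by simp)
  rw [← LieModule.iSup_genWeightSpace_eq_top' K H L, LieSubmodule.iSup_toSubmodule, iSup_le_iff]
  intro α y hy
  by_cases hα : α.IsZero
  · rw [hα.eq, LieSubmodule.mem_toSubmodule] at hy
    exact hH ⟨y, by rwa [← LieSubalgebra.mem_toLieSubmodule, ← rootSpace_zero_eq K L H]⟩
  · let α' : H.root := ⟨α, by simpa using hα⟩
    let _ := (rootSystem H).indexNeg
    rcases RootPairing.Base.IsPos.or_neg b α' with h | h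
    · exact hpos α' h y hy
    · refine hneg _ h y ?_
      have : (-(((-α' : H.root)).1 : H → K)) = α := by
        have := (rootSystem H).root_reflectionPerm α' α'
        rw [(rootSystem H).reflection_apply_self] at this
        funext h
        have h' := congrArg (fun χ : Module.Dual K H => -(χ h)) this
        exact h'.trans (neg_neg _)
      rw [this]
      exact hy

/-- The lowering operators of two orthogonal positive roots annihilating, in pairs, a highest
weight vector, at most one of the two coroots acts nontrivially on it, and it acts by `1`. -/
theorem exists_nat_add_le_one {γ δ : H.root} (hv : v ≠ 0)
    (hpos : ∀ α : H.root, b.IsPos α → ∀ x ∈ LieAlgebra.rootSpace H α.1, σ x v = 0)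
    (hcartan : ∀ h : H, ∃ a : K, σ h v = a • v)
    (hδ : b.IsPos δ) (hlt : b.height δ < b.height γ) (horth : (rootSystem H).pairing δ γ = 0)
    (hlow : ∀ α β : H.root, (α = γ ∨ α = δ) → (β = γ ∨ β = δ) → ∀ x ∈ LieAlgebra.rootSpace H (-(α.1 : H → K)),
      ∀ y ∈ LieAlgebra.rootSpace H (-(β.1 : H → K)), σ x (σ y v) = 0) :
    ∃ p q : ℕ, p + q ≤ 1 ∧ σ (coroot γ.1 : H) v = (p : K) • v ∧
      σ (coroot δ.1 : H) v = (q : K) • v := by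
  have hγ : b.IsPos γ := by rw [b.isPos_iff] at hδ ⊢; omega
  obtain ⟨e₁, f₁, ht₁, he₁, hf₁⟩ := exists_sl2Triple γ
  obtain ⟨e₂, f₂, ht₂, he₂, hf₂⟩ := exists_sl2Triple δ
  obtain ⟨a, ha⟩ := hcartan (coroot γ.1)
  obtain ⟨a', ha'⟩ := hcartan (coroot δ.1)
  obtain ⟨p, rfl, -, hp⟩ := exists_nat_of_primitive ht₁ hv ha (hpos γ hγ e₁ he₁)
  obtain ⟨q, rfl, -, hq⟩ := exists_nat_of_primitive ht₂ hv ha' (hpos δ hδ e₂ he₂)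
  refine ⟨p, q, ?_, ha, ha'⟩
  have hp₁ : p ≤ 1 := by
    by_contra! h
    refine hp 2 h ?_
    rw [pow_two]
    -- If `p ≥ 2`, the square of the lowering operator would not kill `v`.
    exact hlow γ γ (.inl rfl) (.inl rfl) f₁ hf₁ f₁ hf₁
  have hq₁ : q ≤ 1 := by
    by_contra! h
    refine hq 2 h ?_
    rw [pow_two]
    exact hlow δ δ (.inr rfl) (.inr rfl) f₂ hf₂ f₂ hf₂
  by_contra! hpq
  obtain ⟨rfl, rfl⟩ : p = 1 ∧ q = 1 := by omega
  have hw : σ f₂ v ≠ 0 := by simpa using hq 1 le_rfl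
  have hx : ⁅e₁, f₂⁆ ∈ LieAlgebra.rootSpace H ((γ.1 : H → K) + -δ.1) :=
    lie_mem_genWeightSpace_of_mem_genWeightSpace he₁ hf₂
  -- `[e₁, f₂]` has weight `γ - δ`, which is either not a root or, having positive height, a
  -- positive root; both ways it kills `v`.
  have hxv : σ ⁅e₁, f₂⁆ v = 0 := by
    by_cases hbot : LieAlgebra.rootSpace H ((γ.1 : H → K) + -δ.1) = ⊥
    · rw [hbot, LieSubmodule.mem_bot] at hx
      simp [hx]
    · let ε : LieModule.Weight K H L := ⟨_, hbot⟩
      have hε : (ε : H → K) = γ.1 + -δ.1 := rfl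
      have hε₀ : ε.IsNonZero := by
        intro h
        have hz : (γ.1 : H → K) = δ.1 := by
          rw [← sub_eq_zero, sub_eq_add_neg, ← hε, h.eq]
        have : γ = δ := Subtype.ext (DFunLike.coe_injective hz)
        simp [this] at hlt
      let ε' : H.root := ⟨ε, by simpa using hε₀⟩
      refine hpos ε' ?_ _ hx
      have hr : (rootSystem H).root ε' = (rootSystem H).root γ - (rootSystem H).root δ := by
        ext h
        simpa [sub_eq_add_neg] using congrFun hε h
      rw [b.isPos_iff, b.height_sub hr]
      omega
  have hew : σ e₁ (σ f₂ v) = 0 := by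
    have := hxv
    rwa [LieHom.map_lie, Ring.lie_def, LinearMap.sub_apply, Module.End.mul_apply,
      Module.End.mul_apply, hpos γ hγ e₁ he₁, map_zero, sub_zero] at this
  have hfw : ⁅(coroot γ.1 : L), f₂⁆ = (0 : K) • f₂ := by
    have := lie_eq_smul_of_mem_rootSpace hf₂ (coroot γ.1)
    have h₀ : δ.1 (coroot γ.1) = 0 := horth
    simpa [h₀] using this
  have hhw := map_map_eq_of_lie_eq_smul hfw ha
  -- By orthogonality `f₂ v` still has weight 1 for the triple of `γ`, and `e₁` kills it, so `f₁ f₂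
  -- v ≠ 0`, against `hlow`.
  obtain ⟨n, hn, -, h₁⟩ := exists_nat_of_primitive ht₁ hw hhw hew
  obtain rfl : n = 1 := by rw [add_zero] at hn; exact_mod_cast hn.symm
  exact h₁ 1 le_rfl (by simpa using hlow γ δ (.inl rfl) (.inr rfl) f₁ hf₁ f₂ hf₂)

end Representation


/-! ### The obstruction to `φ`-minimality. -/

section PhiMinimal

open LieAlgebra.IsKilling

variable {k : Type*} [LieRing k] [LieAlgebra ℝ k] {V : Type*} [AddCommGroup V] [Module ℂ V]

theorem extend_one_tmul (R : k →ₗ⁅ℝ⁆ Module.End ℂ V) (x : k) :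
    extend R ((1 : ℂ) ⊗ₜ[ℝ] x) = R x := by
  simp [extend]

/-- The complex linear extension of a representation, as a morphism of Lie algebras. -/
def extendHom (R : k →ₗ⁅ℝ⁆ Module.End ℂ V) : ℂ ⊗[ℝ] k →ₗ⁅ℂ⁆ Module.End ℂ V where
  __ := extend R
  map_lie' := by
    intro z w
    change extend R ⁅z, w⁆ = ⁅extend R z, extend R w⁆
    induction z using TensorProduct.induction_on with
    | zero => simp
    | add z z' hz hz' => simp only [add_lie, map_add, hz, hz']
    | tmul a x =>
      induction w using TensorProduct.induction_on with
      | zero => rw [map_zero, lie_zero, lie_zero (a ⊗ₜ[ℝ] x : ℂ ⊗[ℝ] k), map_zero]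
      | add w w' hw hw' =>
        rw [map_add, lie_add, ← hw, ← hw', ← map_add, lie_add (a ⊗ₜ[ℝ] x : ℂ ⊗[ℝ] k)]
      | tmul c y =>
        simp only [LieAlgebra.ExtendScalars.bracket_tmul, extend, LinearMap.liftBaseChange_tmul,
          LieHom.coe_toLinearMap, LieHom.map_lie, Ring.lie_def, smul_mul_smul_comm, smul_sub,
          mul_comm c a]

theorem extendHom_apply (R : k →ₗ⁅ℝ⁆ Module.End ℂ V) (z : ℂ ⊗[ℝ] k) :
    extendHom R z = extend R z := rfl

/-- A nonzero vector of an irreducible representation that is killed by `k` can only be present if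
`k` acts by zero. -/
theorem IsIrreducibleRep.eq_zero_of_map_eq_zero {R : k →ₗ⁅ℝ⁆ Module.End ℂ V}
    (hR : IsIrreducibleRep R) {v : V} (hv : v ≠ 0) (h : ∀ x, R x v = 0) (x : k) : R x = 0 := by
  have hW : ∀ y, ∀ w ∈ ℂ ∙ v, R y w = 0 := fun y w hw => by
    obtain ⟨c, rfl⟩ := Submodule.mem_span_singleton.1 hw
    rw [map_smul, h, smul_zero]
  rcases hR.2.2 (ℂ ∙ v) le_top fun y _ w hw => by rw [hW y w hw]; exact zero_mem _ with h₀ | h₁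
  · exact absurd (Submodule.span_singleton_eq_bot.1 h₀) hv
  · ext w
    exact hW x w (h₁ ▸ Submodule.mem_top)

/-- `V` is the sum of the eigenspaces for `Λ(ρ)` and `Λ(ρ) - i`, so `Λ(ρ) - 2i` is not an
eigenvalue: there is no level 2. -/
theorem eq_zero_of_isCompl_level {t : LieSubalgebra ℝ k} {R : k →ₗ⁅ℝ⁆ Module.End ℂ V}
    {Λ : t →ₗ[ℝ] ℂ} {ρ : t} (h : IsCompl (level R Λ ρ 0) (level R Λ ρ 1)) {w : V}
    (hw : R ρ w = (Λ ρ - 2 * Complex.I) • w) : w = 0 := by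
  obtain ⟨x, hx, y, hy, rfl⟩ := Submodule.mem_sup.1 (h.sup_eq_top ▸ Submodule.mem_top (x := w))
  rw [level, Module.End.mem_eigenspace_iff] at hx hy
  have h₁ : (2 * Complex.I) • x = -(Complex.I • y) := by
    rw [map_add, hx, hy] at hw
    rw [← sub_eq_zero] at hw ⊢
    rw [← hw]
    push_cast
    module
  have h₂ := congrArg (R ρ) h₁
  rw [map_smul, map_neg, map_smul, hx, hy, smul_comm, h₁] at h₂
  have h₃ : y = 0 := by
    have : (Complex.I * Complex.I) • y = 0 := by
      rw [← sub_eq_zero] at h₂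
      rw [← neg_eq_zero, ← h₂]
      push_cast
      module
    simpa using this
  subst h₃
  simpa using h₁

theorem exists_extendHom_eq_smul {t : LieSubalgebra ℝ k}
    {R : k →ₗ⁅ℝ⁆ Module.End ℂ V} {Λ : t →ₗ[ℝ] ℂ} {v : V}
    (hv : ∀ h : t, R h v = Λ h • v) (h : complexify t) : ∃ a : ℂ, extendHom R h v = a • v := by
  obtain ⟨h, hh⟩ := h
  obtain ⟨x, y, rfl⟩ := exists_re_im h
  obtain ⟨hx, hy⟩ := (re_im_mem_complexify_iff t).1 hh
  refine ⟨Λ ⟨x, hx⟩ + Complex.I * Λ ⟨y, hy⟩, ?_⟩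
  rw [extendHom_apply, map_add, map_smul, extend_one_tmul, extend_one_tmul, LinearMap.add_apply,
    LinearMap.smul_apply, hv ⟨x, hx⟩, hv ⟨y, hy⟩]
  module

variable [IsCompactSemisimple k] [FiniteDimensional ℝ k]
  {t : LieSubalgebra ℝ k} [t.IsCartanSubalgebra] {b : (rootSys t).Base}

theorem HasCoeffs.apply_rho {n : ℕ} {e : Fin n ≃ b.support} {c : Fin n → ℤ} {γ : Root t}
    (hγ : HasCoeffs e c γ) {j : Fin n} {ρ : t} (hρ : IsRhoPhi b (e j) ρ) :
    γ.1 (toComplexify t ρ) = c j * Complex.I := by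
  have h : γ.1 (toComplexify t ρ) = ∑ i, c i • (e i : Root t).1 (toComplexify t ρ) := by
    have := congrArg (fun χ : Module.Dual ℂ (complexify t) => χ (toComplexify t ρ)) hγ.root_eq
    simpa using this
  rw [h, Finset.sum_eq_single j]
  · rw [hρ.2, zsmul_eq_mul]
  · intro i _ hij
    have hc : IsCompactRoot b (e j) (e i : Root t) := by
      rw [IsCompactRoot, b.toWeightBasis_repr_root, Finsupp.single_eq_of_ne]
      simpa using Ne.symm hij
    rw [hρ.1 _ hc, smul_zero]
  · simp

variable [FiniteDimensional ℂ V]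

/-- An irreducible representation is not `φ`-minimal if there are two orthogonal positive roots
`γ`, `δ` whose coefficients along `φ` are `1` and such that all the coefficients of `γ + δ` are
at least `2`. -/
theorem not_isPhiMinimal_of_hasCoeffs {n : ℕ} {e : Fin n ≃ b.support}
    {C : Matrix (Fin n) (Fin n) ℤ} (hC : ∀ i j, b.cartanMatrix (e i) (e j) = C i j)
    {c d : Fin n → ℤ} {γ δ : Root t} (hγ : HasCoeffs e c γ) (hδ : HasCoeffs e d δ)
    (horth : ∑ i, ∑ j, d i * c j * C i j = 0) (hd : 0 < ∑ i, d i) (hcd : ∑ i, d i < ∑ i, c i)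
    (htwo : ∀ i, 2 ≤ c i + d i) {j : Fin n} (hcj : c j = 1) (hdj : d j = 1)
    {R : k →ₗ⁅ℝ⁆ Module.End ℂ V} (hR : IsIrreducibleRep R) : ¬ IsPhiMinimal b (e j) R := by
  rintro ⟨Λ, ρ, ⟨v, hv, hvΛ, hvpos⟩, hρ, hcompl, -, hlevel, -⟩
  have hρR : ∀ w : V, extendHom R (toComplexify t ρ) w = R ρ w := fun w => by
    rw [extendHom_apply, toComplexify, extend_one_tmul]
  have hlow : ∀ α β : Root t, (α = γ ∨ α = δ) → (β = γ ∨ β = δ) →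
      ∀ x ∈ LieAlgebra.rootSpace (complexify t) (-(α.1 : complexify t → ℂ)),
      ∀ y ∈ LieAlgebra.rootSpace (complexify t) (-(β.1 : complexify t → ℂ)),
        extendHom R x (extendHom R y v) = 0 := by
    have hI : ∀ α : Root t, (α = γ ∨ α = δ) → α.1 (toComplexify t ρ) = Complex.I := by
      rintro α (rfl | rfl)
      · simp [hγ.apply_rho hρ, hcj]
      · simp [hδ.apply_rho hρ, hdj]
    intro α β hα hβ x hx y hy
    have hx' := lie_eq_smul_of_mem_rootSpace hx (toComplexify t ρ)
    have hy' := lie_eq_smul_of_mem_rootSpace hy (toComplexify t ρ)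
    have h₀ : extendHom R (toComplexify t ρ) v = Λ ρ • v := by rw [hρR, hvΛ]
    have h₂ := map_map_eq_of_lie_eq_smul hx' (map_map_eq_of_lie_eq_smul hy' h₀)
    refine eq_zero_of_isCompl_level hcompl ?_
    rw [← hρR, h₂, Pi.neg_apply, Pi.neg_apply, hI α hα, hI β hβ]
    congr 1
    ring
  have hpos : ∀ α : Root t, b.IsPos α → ∀ x ∈ LieAlgebra.rootSpace (complexify t) α.1,
      extendHom R x v = 0 := hvpos
  have hcartan := exists_extendHom_eq_smul hvΛ
  obtain ⟨p, q, hpq, hp, hq⟩ := exists_nat_add_le_one hv hpos hcartan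
    (by rwa [b.isPos_iff, hδ.height_eq]) (by rwa [hδ.height_eq, hγ.height_eq])
    (by rw [HasCoeffs.pairing_eq hC hδ hγ, horth, Int.cast_zero]) hlow
  -- The `m i` are the Dynkin labels of `Λ`.
  have hsimple : ∀ i : Fin n, ∃ m : ℕ,
      extendHom R (coroot (e i : Root t).1 : complexify t) v = (m : ℂ) • v := fun i => by
    obtain ⟨x, y, ht, hx, -⟩ := exists_sl2Triple (e i : Root t)
    obtain ⟨a, ha⟩ := hcartan (coroot (e i : Root t).1)
    obtain ⟨m, rfl, -⟩ := exists_nat_of_primitive ht hv ha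
      (hpos _ (RootPairing.Base.isPos_of_mem_support (e i).2) x hx)
    exact ⟨m, ha⟩
  choose m hm using hsimple
  have hsum : ∀ {r : ℕ} {a : Fin n → ℤ} {α : Root t}, HasCoeffs e a α →
      extendHom R (coroot α.1 : complexify t) v = (r : ℂ) • v → (r : ℤ) = ∑ i, a i * m i := by
    intro r a α hα hr
    have h : (coroot α.1 : complexify t) = ∑ i, a i • coroot (e i : Root t).1 := hα.coroot_eq
    have h' : extendHom R (coroot α.1 : complexify t) v = ((∑ i, a i * m i : ℤ) : ℂ) • v := by
      rw [h]
      push_cast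
      simp [Finset.sum_smul, mul_smul, hm, map_sum, LinearMap.sum_apply, Int.cast_smul_eq_zsmul, smul_comm (m _ : ℂ)]
    exact_mod_cast smul_left_injective ℂ hv (hr.symm.trans h')
  -- `2 mᵢ ≤ p + q ≤ 1` forces `mᵢ = 0`.
  have hm₀ : ∀ i, m i = 0 := by
    intro i
    have h₁ : ((p + q : ℕ) : ℤ) = ∑ i, (c i + d i) * m i := by
      rw [Nat.cast_add, hsum hγ hp, hsum hδ hq, ← Finset.sum_add_distrib]
      exact Finset.sum_congr rfl fun _ _ => by ring
    have h₂ : 2 * (m i : ℤ) ≤ ∑ i, (c i + d i) * m i :=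
      (mul_le_mul_of_nonneg_right (htwo i) (by positivity)).trans
        (Finset.single_le_sum (f := fun i => (c i + d i) * (m i : ℤ))
          (fun i _ => mul_nonneg (by linarith [htwo i]) (by positivity)) (Finset.mem_univ i))
    omega
  have hkill := map_eq_zero_of_simple hv hpos fun i => by
    have := hm (e.symm i)
    simpa [hm₀] using this
  have hzero := hR.eq_zero_of_map_eq_zero hv fun x => by
    rw [← extend_one_tmul R x, ← extendHom_apply, hkill]
  have hΛ : Λ ρ = 0 := by
    have := hvΛ ρ
    rw [hzero] at this
    simpa [hv] using this.symm
  -- Now `ρ` acts by 0, while level 1 is its eigenspace for `-i`.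
  refine hlevel ((Submodule.eq_bot_iff _).2 fun w hw => ?_)
  rw [level, Module.End.mem_eigenspace_iff, hzero, hΛ] at hw
  simpa using hw.symm

/-! ### The pairs of roots in `E₆` and `E₇`. -/

theorem cartanE6_isSymm : cartanE6.IsSymm := by decide

theorem cartanE7_isSymm : cartanE7.IsSymm := by decide

theorem not_isPhiMinimal_E6 (e : Fin 6 ≃ b.support)
    (he : ∀ i j, b.cartanMatrix (e i) (e j) = cartanE6 i j) {R : k →ₗ⁅ℝ⁆ Module.End ℂ V}
    (hR : IsIrreducibleRep R) : ¬ IsPhiMinimal b (e 5) R := by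
  -- `γ` is the highest root, orthogonal to all simple roots but `α₄`; `δ` is the highest root of
  -- the `A₅` left after removing `α₄`.
  obtain ⟨γ, hγ⟩ := HasCoeffs.exists_foldr he cartanE6_isSymm [3, 2, 1, 0, 4, 2, 1, 3, 2, 4] 5
  obtain ⟨δ, hδ⟩ := HasCoeffs.exists_foldr he cartanE6_isSymm [0, 1, 2, 4] 5
  have hc : [3, 2, 1, 0, 4, 2, 1, 3, 2, 4].foldr (reflectCoeffs cartanE6) (Pi.single 5 1) =
    ![1, 2, 3, 2, 2, 1] := by decide +kernel
  have hd : [0, 1, 2, 4].foldr (reflectCoeffs cartanE6) (Pi.single 5 1) =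
    ![1, 1, 1, 0, 1, 1] := by decide +kernel
  rw [hc] at hγ
  rw [hd] at hδ
  exact not_isPhiMinimal_of_hasCoeffs he hγ hδ (by decide) (by decide) (by decide) (by decide)
    rfl rfl hR

theorem not_isPhiMinimal_E7 (e : Fin 7 ≃ b.support)
    (he : ∀ i j, b.cartanMatrix (e i) (e j) = cartanE7 i j) {R : k →ₗ⁅ℝ⁆ Module.End ℂ V}
    (hR : IsIrreducibleRep R) : ¬ IsPhiMinimal b (e 0) R := by
  -- `γ` is the highest root, orthogonal to all simple roots but `α₇`; `δ` is the highest root of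
  -- the `D₆` left after removing `α₇`.
  obtain ⟨γ, hγ⟩ := HasCoeffs.exists_foldr he cartanE7_isSymm
    [6, 5, 3, 2, 1, 0, 4, 3, 2, 1, 5, 3, 2, 4, 3, 5] 6
  obtain ⟨δ, hδ⟩ := HasCoeffs.exists_foldr he cartanE7_isSymm [1, 0, 2, 1, 3, 2, 4, 3] 5
  have hc : [6, 5, 3, 2, 1, 0, 4, 3, 2, 1, 5, 3, 2, 4, 3, 5].foldr (reflectCoeffs cartanE7)
    (Pi.single 6 1) = ![1, 2, 3, 4, 2, 3, 2] := by decide +kernel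
  have hd : [1, 0, 2, 1, 3, 2, 4, 3].foldr (reflectCoeffs cartanE7) (Pi.single 5 1) =
    ![1, 2, 2, 2, 1, 1, 0] := by decide +kernel
  rw [hc] at hγ
  rw [hd] at hδ
  exact not_isPhiMinimal_of_hasCoeffs he hγ hδ (by decide) (by decide) (by decide) (by decide)
    rfl rfl hR

end PhiMinimal

end CompactHermitian

end

theorem mainTheorem3 {k : Type*} [LieRing k] [LieAlgebra ℝ k] [FiniteDimensional ℝ k]
    [CompactHermitian.IsCompactSemisimple k]
    (t : LieSubalgebra ℝ k) [t.IsCartanSubalgebra]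
    (b : (CompactHermitian.rootSys t).Base) :
    (∀ e : Fin 6 ≃ b.support,
        (∀ i j, b.cartanMatrix (e i) (e j) = CompactHermitian.cartanE6 i j) →
        ∀ {V : Type*} [AddCommGroup V] [Module ℂ V] [FiniteDimensional ℂ V]
          (R : k →ₗ⁅ℝ⁆ Module.End ℂ V), CompactHermitian.IsIrreducibleRep R →
          ¬ CompactHermitian.IsPhiMinimal b (e 5) R) ∧
    (∀ e : Fin 7 ≃ b.support,
        (∀ i j, b.cartanMatrix (e i) (e j) = CompactHermitian.cartanE7 i j) →
        ∀ {V : Type*} [AddCommGroup V] [Module ℂ V] [FiniteDimensional ℂ V]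
          (R : k →ₗ⁅ℝ⁆ Module.End ℂ V), CompactHermitian.IsIrreducibleRep R →
          ¬ CompactHermitian.IsPhiMinimal b (e 0) R) := by
  exact ⟨fun e he _ _ _ _ _ hR => CompactHermitian.not_isPhiMinimal_E6 e he hR,
    fun e he _ _ _ _ _ hR => CompactHermitian.not_isPhiMinimal_E7 e he hR⟩
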